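/- Let $K$ be an imaginary quadratic field with discriminant $\Delta<0$ and ring of integers $\mathcal{O}_K$, viewed inside $\mathbb{C}$ by a complex embedding. Let $\mathrm{PSL}_2(\mathcal{O}_K)$ act on $\widehat{\mathbb{C}}=\mathbb{C}\cup\{\infty\}$ by Möbius transformations. The $K$-Bianchi circles are the images of $\widehat{\mathbb{R}}=\mathbb{R}\cup\{\infty\}$ under the elements of $\mathrm{PSL}_2(\mathcal{O}_K)$, and the Schmidt arrangement $\mathcal{S}_K\subset\widehat{\mathbb{C}}$ is their union, with the subspace topology. Put $\sqrt{\Delta}=i\sqrt{|\Delta|}$. The ghost circle of $K$ is the circle of positive radius (if it exists) that is orthogonal to the unit circle $|z|=1$ and has centre $$\tfrac12+\tfrac{\sqrt{\Delta}}{4}\ \text{ if } \Delta\equiv 0 \pmod 4,\qquad \tfrac12+\tfrac{-\Delta-1}{4\sqrt{\Delta}}\ \text{ if } \Delta\equiv 1\pmod 4 .$$ Then: 1. $\mathcal{S}_K$ is connected if and only if $\mathcal{O}_K$ is a Euclidean domain. 2. If $\mathcal{S}_K$ is disconnected, it has infinitely many connected components. 3. If $\mathcal{S}_K$ is disconnected,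 then $K$ has a ghost circle $G$, and for every $\lambda\in\mathcal{O}_K$ no $K$-Bianchi circle meets the translate $G+\lambda$, while $\mathcal{S}_K$ meets both the interior and the exterior of $G+\lambda$ in $\widehat{\mathbb{C}}$. Moreover, there are infinitely many $\lambda\in\mathcal{O}_K$ for which the interiors of the circles $G+\lambda$ are pairwise disjoint. -/

import Mathlib

open scoped NumberField MatrixGroups
open OnePoint

noncomputable section

namespace Schmidt

/-- The extended real line, as a subset of the Riemann sphere (the one-point compactification
of `ℂ`). -/
def extendedReals : Set (OnePoint ℂ) :=
  insert ∞ (Set.range fun x : ℝ => ((x : ℂ) : OnePoint ℂ))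

variable {K : Type*} [Field K]

/-- The invertible complex matrix obtained from a matrix in `SL₂` of the ring of integers by
applying a complex embedding `σ` to its entries. Complex invertible matrices act on the Riemann
sphere by Möbius transformations: `(a, b; c, d)` sends `z` to `(a z + b) / (c z + d)`. -/
def toGLComplex (σ : K →+* ℂ) (M : SL(2, 𝓞 K)) : GL (Fin 2) ℂ :=
  Matrix.SpecialLinearGroup.toGL
    (Matrix.SpecialLinearGroup.map (σ.comp (algebraMap (𝓞 K) K)) M)

/-- `M` and `-M` act in the same way, so the orbits of `SL₂` and of `PSL₂` are the same. -/
theorem toGLComplex_neg_smul (σ : K →+* ℂ) (M : SL(2, 𝓞 K)) (z : OnePoint ℂ) :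
    toGLComplex σ (-M) • z = toGLComplex σ M • z := by
  have h (i j : Fin 2) : (toGLComplex σ (-M)) i j = -(toGLComplex σ M) i j := by
    simp [toGLComplex]
  cases z with
  | infty => simp only [OnePoint.smul_infty_eq_ite, h, neg_eq_zero, neg_div_neg_eq]
  | coe z =>
    simp only [OnePoint.smul_some_eq_ite, h, neg_mul, ← neg_add, neg_eq_zero, neg_div_neg_eq]

/-- A `K`-Bianchi circle: the image of the extended real line under an element of
`PSL₂(𝓞 K)`. -/
def IsBianchiCircle (σ : K →+* ℂ) (C : Set (OnePoint ℂ)) : Prop :=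
  ∃ M : SL(2, 𝓞 K), C = (fun z => toGLComplex σ M • z) '' extendedReals

/-- The Schmidt arrangement as a subset of the Riemann sphere: the union of all
`K`-Bianchi circles. -/
def arrangement (σ : K →+* ℂ) : Set (OnePoint ℂ) :=
  ⋃₀ {C | IsBianchiCircle σ C}

/-- A commutative ring is a Euclidean domain if it carries a Euclidean domain structure
with the given ring operations. -/
def IsEuclidean (R : Type*) [CommRing R] : Prop :=
  ∃ E : EuclideanDomain R, E.toCommRing = (inferInstance : CommRing R)

/-- Two circles in the plane are orthogonal if they meet, and at every common point their
radii are perpendicular. -/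
def AreOrthogonal (G H : EuclideanGeometry.Sphere ℂ) : Prop :=
  (∃ p, p ∈ G ∧ p ∈ H) ∧
    ∀ p, p ∈ G → p ∈ H → inner ℝ (p - G.center) (p - H.center) = 0

/-- The square root `i √|Δ|` of the (negative) discriminant `Δ`. -/
def sqrtDiscr (K : Type*) [Field K] [NumberField K] : ℂ :=
  Complex.I * (Real.sqrt (-(NumberField.discr K : ℝ)) : ℂ)

/-- The centre of the ghost circle. -/
def ghostCenter (K : Type*) [Field K] [NumberField K] : ℂ :=
  if NumberField.discr K % 4 = 0 then
    1 / 2 + sqrtDiscr K / 4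
  else
    1 / 2 + (-(NumberField.discr K : ℂ) - 1) / (4 * sqrtDiscr K)

/-- `G` is a ghost circle for `K`: a circle (of positive radius) with the prescribed centre that
is orthogonal to the unit circle. -/
def IsGhostCircle (K : Type*) [Field K] [NumberField K] (G : EuclideanGeometry.Sphere ℂ) : Prop :=
  0 < G.radius ∧ G.center = ghostCenter K ∧ AreOrthogonal G ⟨0, 1⟩

/-- The circle with centre `c` and radius `r`, in the Riemann sphere. -/
def circle (c : ℂ) (r : ℝ) : Set (OnePoint ℂ) := (fun z : ℂ => (z : OnePoint ℂ)) '' Metric.sphere c r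

/-- The interior of the circle with centre `c` and radius `r`, in the Riemann sphere. -/
def inside (c : ℂ) (r : ℝ) : Set (OnePoint ℂ) := (fun z : ℂ => (z : OnePoint ℂ)) '' Metric.ball c r

/-- The exterior of the circle with centre `c` and radius `r`, in the Riemann sphere; it
contains `∞`. -/
def outside (c : ℂ) (r : ℝ) : Set (OnePoint ℂ) :=
  ((fun z : ℂ => (z : OnePoint ℂ)) '' Metric.closedBall c r)ᶜ

end Schmidt

end

/-! Everything depends on the size of Δ. Since −12 is not the discriminant of a maximal order,
either Δ > −12 or Δ < −12.

If Δ > −12, every complex number lies at distance less than 1 from the lattice, so the ring is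
norm-Euclidean (`isEuclidean_of_discr`). Any Euclidean structure, for the norm or not, makes the
arrangement connected: division applied to the lower row of a matrix links its circle, through
circles sharing points, to one through ∞ (`isConnected_arrangement`).

If Δ < −12, the ghost circle exists. With s = √|Δ|, a Bianchi circle has equation k s|z|² + 2 Im(ζz)
+ m s = 0, where k and m are integers and ζ ≡ 1 modulo √Δ (`bianchi_coefficients`). Its inversive
product with the ghost circle therefore takes discrete values, all larger than 1 in absolute value,
whereas circles that meet have product at most 1 (`normSq_sub_ghostCenter_ne`). The arrangement is
dense, so disjoint translates of the ghost circle cut off infinitely many nonempty clopen parts. It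
then has infinitely many components, and the ring admits no Euclidean structure at all. -/

noncomputable section

namespace Schmidt

/-! ### The ring of integers as a lattice in the plane -/

section Lattice

/-- The image of the ring of integers under a complex embedding has a non-real generator. -/
theorem exists_im_ne_zero {K : Type*} [Field K] [NumberField K]
    [NumberField.IsTotallyComplex K] (σ : K →+* ℂ) : ∃ x : 𝓞 K, (σ x).im ≠ 0 := by
  by_contra! h
  refine NumberField.IsTotallyComplex.complexEmbedding_not_isReal σ ?_
  rw [NumberField.ComplexEmbedding.isReal_iff]
  ext x
  obtain ⟨a, b, -, rfl⟩ := IsFractionRing.div_surjective (A := 𝓞 K) x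
  have h' (y : 𝓞 K) : (starRingEnd ℂ) (σ y) = σ y := Complex.conj_eq_iff_im.2 (h y)
  simp [NumberField.ComplexEmbedding.conjugate_coe_eq, h']

theorem sqrtDiscr_mul_self (K : Type*) [Field K] [NumberField K]
    (h : NumberField.discr K < 0) :
    sqrtDiscr K * sqrtDiscr K = NumberField.discr K := by
  have : (0 : ℝ) ≤ -(NumberField.discr K : ℝ) := by
    have : (NumberField.discr K : ℝ) < 0 := by exact_mod_cast h
    linarith
  have h2 := Real.mul_self_sqrt this
  rw [sqrtDiscr, mul_mul_mul_comm, Complex.I_mul_I, ← Complex.ofReal_mul, h2]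
  push_cast
  ring

variable (K : Type*) [Field K] [NumberField K] [Algebra.IsQuadraticExtension ℚ K]

/-- The ring of integers of a quadratic field is generated by `1` and one more element. -/
theorem exists_integral_generator :
    ∃ ω : 𝓞 K, ∀ x : 𝓞 K, ∃ m n : ℤ, x = m + n * ω := by
  have hrank : Module.finrank ℤ (𝓞 K) = 2 := by
    rw [NumberField.RingOfIntegers.rank, Algebra.IsQuadraticExtension.finrank_eq_two]
  let b : Module.Basis (Fin 2) ℤ (𝓞 K) := Module.finBasisOfFinrankEq ℤ (𝓞 K) hrank
  have hb (x : 𝓞 K) : x = (b.repr x 0 : 𝓞 K) * b 0 + (b.repr x 1 : 𝓞 K) * b 1 := by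
    conv_lhs => rw [← b.sum_repr x]
    simp [Fin.sum_univ_two, zsmul_eq_mul]
  obtain ⟨p, q, hpq⟩ : ∃ p q : ℤ, (1 : 𝓞 K) = p * b 0 + q * b 1 := ⟨_, _, hb 1⟩
  have hcop : IsCoprime p q := by
    rw [Int.isCoprime_iff_gcd_eq_one]
    obtain ⟨p', hp⟩ := Int.gcd_dvd_left p q
    obtain ⟨q', hq⟩ := Int.gcd_dvd_right p q
    set g := Int.gcd p q
    -- The gcd divides 1 in the ring of integers, so its norm g² is a unit of ℤ.
    have hg : IsUnit (algebraMap ℤ (𝓞 K) g) := by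
      refine IsUnit.of_mul_eq_one (p' * b 0 + q' * b 1) ?_
      rw [hpq, hp, hq]
      simp
      ring
    have := hg.map (Algebra.norm ℤ)
    rw [Algebra.norm_algebraMap, hrank, isUnit_pow_iff two_ne_zero] at this
    simpa [Int.isUnit_iff_natAbs_eq] using this
  obtain ⟨u, v, huv⟩ := hcop
  have huv' : (u * p + v * q : 𝓞 K) = 1 := by exact_mod_cast congrArg (Int.cast (R := 𝓞 K)) huv
  -- The rows (p, q) and (−v, u) have determinant 1, so 1 and this element again form a basis.
  refine ⟨-v * b 0 + u * b 1, fun x => ?_⟩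
  obtain ⟨y, z, h⟩ : ∃ y z : ℤ, x = y * b 0 + z * b 1 := ⟨_, _, hb x⟩
  refine ⟨y * u + z * v, -y * q + z * p, ?_⟩
  rw [h]
  push_cast
  linear_combination (-(y : 𝓞 K) * b 0 - z * b 1) * huv' - ((y : 𝓞 K) * u + z * v) * hpq

theorem exists_quadratic_generator :
    ∃ (ω : 𝓞 K) (A B : ℤ), (∀ x : 𝓞 K, ∃ m n : ℤ, x = m + n * ω) ∧ ω * ω = A + B * ω ∧
      NumberField.discr K = 4 * A + B ^ 2 := by
  obtain ⟨ω, hω⟩ := exists_integral_generator K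
  obtain ⟨A, B, hAB⟩ := hω (ω * ω)
  refine ⟨ω, A, B, hω, hAB, ?_⟩
  have hrank : Module.finrank ℤ (𝓞 K) = 2 := by
    rw [NumberField.RingOfIntegers.rank, Algebra.IsQuadraticExtension.finrank_eq_two]
  let b : Module.Basis (Fin 2) ℤ (𝓞 K) := basisOfTopLeSpanOfCardEqFinrank ![1, ω] (by
    intro x _
    obtain ⟨m, n, rfl⟩ := hω x
    rw [Matrix.range_cons, Matrix.range_cons, Matrix.range_empty, Set.union_empty,
      Set.singleton_union, Submodule.mem_span_pair]
    exact ⟨m, n, by simp⟩) (by simp [hrank])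
  have hb0 : b 0 = 1 := by simp [b]
  have hb1 : b 1 = ω := by simp [b]
  have hrep (m n : ℤ) : b.repr (m + n * ω) = Finsupp.single 0 m + Finsupp.single 1 n := by
    have : (m + n * ω : 𝓞 K) = m • b 0 + n • b 1 := by simp [hb0, hb1]
    rw [this, map_add, map_zsmul, map_zsmul, b.repr_self, b.repr_self]
    simp
  have htr (m n : ℤ) : Algebra.trace ℤ (𝓞 K) (m + n * ω) = 2 * m + n * B := by
    rw [Algebra.trace_eq_matrix_trace b, Matrix.trace_fin_two, Algebra.leftMulMatrix_eq_repr_mul,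
      Algebra.leftMulMatrix_eq_repr_mul, hb0, hb1, mul_one,
      show (m + n * ω) * ω = ((n * A : ℤ) : 𝓞 K) + ((m + n * B : ℤ) : 𝓞 K) * ω by
        push_cast; linear_combination (n : 𝓞 K) * hAB, hrep, hrep]
    simp
    ring
  have h1 := htr 1 0
  have h2 := htr 0 1
  have h3 := htr A B
  simp only [Int.cast_one, Int.cast_zero, zero_mul, add_zero, zero_add, one_mul] at h1 h2
  rw [← hAB] at h3
  rw [← NumberField.discr_eq_discr K b, Algebra.discr_def, Matrix.det_fin_two]
  simp only [Algebra.traceMatrix_apply, Algebra.traceForm_apply, hb0, hb1, mul_one, one_mul,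
    h1, h2, h3]
  ring

variable [NumberField.IsTotallyComplex K]

/-- The coordinates of the ring of integers of an imaginary quadratic field in `ℂ`. -/
theorem ringOfIntegers_coordinates (σ : K →+* ℂ) :
    NumberField.discr K < 0 ∧
    (NumberField.discr K % 4 = 0 ∨ NumberField.discr K % 4 = 1) ∧
    (∀ x : 𝓞 K, ∃ u v : ℤ, (2 : ℤ) ∣ u - v * NumberField.discr K ∧
      σ x = (u + v * sqrtDiscr K) / 2) ∧
    (∀ u v : ℤ, (2 : ℤ) ∣ u - v * NumberField.discr K →
      ∃ x : 𝓞 K, σ x = (u + v * sqrtDiscr K) / 2) := by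
  obtain ⟨ω, A, B, hω, hAB, hd⟩ := exists_quadratic_generator K
  have hAB' : σ ω * σ ω = A + B * σ ω := by
    have := congrArg (fun x : 𝓞 K => σ x) hAB
    simpa using this
  have him : (σ ω).im ≠ 0 := by
    obtain ⟨x, hx⟩ := exists_im_ne_zero σ
    obtain ⟨m, n, rfl⟩ := hω x
    intro h
    simp [h] at hx
  have hre : 2 * (σ ω).re = B := by
    have := congrArg Complex.im hAB'
    simp at this
    apply mul_right_cancel₀ him
    linear_combination this
  have hsq : 4 * (σ ω).im ^ 2 = -(NumberField.discr K : ℝ) := by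
    have := congrArg Complex.re hAB'
    simp at this
    rw [hd]
    push_cast
    linear_combination -4 * this + (2 * (σ ω).re - B) * hre
  have hneg : NumberField.discr K < 0 := by
    have : 0 < (σ ω).im ^ 2 := by positivity
    have : (NumberField.discr K : ℝ) < 0 := by linarith
    exact_mod_cast this
  have hB : (2 : ℤ) ∣ B - NumberField.discr K := by
    rw [hd]
    obtain ⟨k, hk⟩ := (Int.even_mul_succ_self (B - 1))
    exact ⟨-k - 2 * A, by linear_combination -hk⟩
  have hmod : NumberField.discr K % 4 = 0 ∨ NumberField.discr K % 4 = 1 := by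
    rw [hd]
    rcases Int.even_or_odd' B with ⟨k, rfl | rfl⟩
    · left; ring_nf; omega
    · right; ring_nf; omega
  -- The sign e records whether the generator lands in the upper or the lower half-plane.
  obtain ⟨e, he, heω⟩ : ∃ e : ℤ, e * e = 1 ∧ σ ω = (B + e * sqrtDiscr K) / 2 := by
    have h2 : (2 * (σ ω).im) ^ 2 = Real.sqrt (-(NumberField.discr K : ℝ)) ^ 2 := by
      rw [Real.sq_sqrt (by have : (NumberField.discr K : ℝ) < 0 := by exact_mod_cast hneg
                           linarith)]
      linarith
    rcases sq_eq_sq_iff_eq_or_eq_neg.1 h2 with h | h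
    · refine ⟨1, by norm_num, Complex.ext ?_ ?_⟩ <;> simp [sqrtDiscr, ← h, ← hre]
    · refine ⟨-1, by norm_num, Complex.ext ?_ ?_⟩
      · simp [sqrtDiscr, ← hre]
      · simp [sqrtDiscr, ← h]
  refine ⟨hneg, hmod, fun x => ?_, fun u v huv => ?_⟩
  · obtain ⟨m, n, rfl⟩ := hω x
    refine ⟨2 * m + n * B, n * e, ?_, ?_⟩
    · have he2 : (2 : ℤ) ∣ 1 - e := by
        rcases Int.mul_eq_one_iff_eq_one_or_neg_one.1 he with ⟨rfl, -⟩ | ⟨rfl, -⟩ <;> norm_num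
      obtain ⟨k, hk⟩ := hB
      obtain ⟨l, hl⟩ := he2
      exact ⟨m + n * k + n * l * NumberField.discr K,
        by linear_combination n * hk + n * NumberField.discr K * hl⟩
    · simp [heω]
      ring
  · have : (2 : ℤ) ∣ u - v * e * B := by
      have he2 : (2 : ℤ) ∣ 1 - e := by
        rcases Int.mul_eq_one_iff_eq_one_or_neg_one.1 he with ⟨rfl, -⟩ | ⟨rfl, -⟩ <;> norm_num
      obtain ⟨k, hk⟩ := hB
      obtain ⟨l, hl⟩ := he2
      obtain ⟨j, hj⟩ := huv
      exact ⟨j - v * e * k + v * l * NumberField.discr K,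
        by linear_combination hj - v * e * hk + v * NumberField.discr K * hl⟩
    obtain ⟨k, hk⟩ := this
    refine ⟨k + (v * e : ℤ) * ω, ?_⟩
    have hk' : (u : ℂ) - v * e * B = 2 * k := by exact_mod_cast congrArg (Int.cast (R := ℂ)) hk
    have he' : (e : ℂ) * e = 1 := by exact_mod_cast congrArg (Int.cast (R := ℂ)) he
    simp [heω]
    linear_combination -hk' / 2 + v * sqrtDiscr K / 2 * he'

/-- The order `ℤ[√-3]` is not integrally closed. -/
theorem discr_ne_neg_twelve (σ : K →+* ℂ) : NumberField.discr K ≠ -12 := by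
  intro h
  obtain ⟨-, -, h1, h2⟩ := ringOfIntegers_coordinates K σ
  have hs := sqrtDiscr_mul_self K (by rw [h]; norm_num)
  -- Here x is √−3. The integral element (1 + √−3)/2 would then need the coordinate v = 1/2.
  obtain ⟨x, hx⟩ := h2 0 1 (by rw [h]; norm_num)
  have hσ : Function.Injective σ := σ.injective
  have hx2 : (x : K) * x = -3 := by
    apply hσ
    simp only [map_mul, map_neg, map_ofNat, hx]
    rw [h] at hs
    push_cast at hs ⊢
    linear_combination hs / 4
  have hint : IsIntegral ℤ ((1 + (x : K)) / 2) := by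
    refine ⟨Polynomial.X ^ 2 - Polynomial.X + 1, by monicity!, ?_⟩
    simp
    linear_combination hx2 / 4
  obtain ⟨u, v, huv, hy⟩ := h1 ⟨_, hint⟩
  change σ ((1 + (x : K)) / 2) = _ at hy
  rw [map_div₀, map_ofNat] at hy
  simp [hx] at hy
  have hre := congrArg Complex.re hy
  have him := congrArg Complex.im hy
  have hpos : 0 < √(-(NumberField.discr K : ℝ)) := Real.sqrt_pos.2 (by rw [h]; norm_num)
  simp [sqrtDiscr] at hre him
  have hv : (1 : ℝ) = 2 * v := by
    apply mul_right_cancel₀ hpos.ne'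
    linarith
  have : (1 : ℤ) = 2 * v := by exact_mod_cast hv
  omega

end Lattice

/-! ### Equations of Bianchi circles and the inversive product -/

section GhostCircle

/-- If a line or circle `k s (x² + y²) / 2 + (p y + q x) + m s / 2 = 0`, normalised by
`p² + q² - k m s² = 1`, has a common point with the circle of centre `(c₁, c₂)` that is orthogonal
to the unit circle, then their inversive product is bounded. -/
theorem inversive_product_sq_le {k m s p q x y c₁ c₂ : ℝ} (hn : p ^ 2 + q ^ 2 = 1 + k * m * s ^ 2)
    (he : k * s * (x ^ 2 + y ^ 2) + 2 * (p * y + q * x) + m * s = 0)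
    (hg : x ^ 2 + y ^ 2 = 2 * (c₁ * x + c₂ * y) - 1) :
    (2 * (p * c₂ + q * c₁) + (k + m) * s) ^ 2 ≤ 4 * (c₁ ^ 2 + c₂ ^ 2 - 1) := by
  -- Half the gradient of the first equation is a unit normal, also for a line (k = 0). Pairing it
  -- with the radius vector of the second circle and applying Cauchy–Schwarz gives the bound.
  have h1 : (k * s * x + q) ^ 2 + (k * s * y + p) ^ 2 = 1 := by
    linear_combination hn + k * s * he
  have h2 : (x - c₁) ^ 2 + (y - c₂) ^ 2 = c₁ ^ 2 + c₂ ^ 2 - 1 := by linear_combination hg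
  have h3 : 2 * ((k * s * x + q) * (x - c₁) + (k * s * y + p) * (y - c₂)) =
      -(2 * (p * c₂ + q * c₁) + (k + m) * s) := by
    linear_combination he + k * s * hg
  rw [← h2, ← neg_sq, ← h3]
  nlinarith [sq_nonneg ((k * s * x + q) * (y - c₂) - (k * s * y + p) * (x - c₁)),
    congrArg (· * ((x - c₁) ^ 2 + (y - c₂) ^ 2)) h1]

variable {K : Type*} [Field K]

theorem toGLComplex_apply (σ : K →+* ℂ) (M : SL(2, 𝓞 K)) (i j : Fin 2) :
    toGLComplex σ M i j = σ (M i j) := rfl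

theorem toGLComplex_mul (σ : K →+* ℂ) (M N : SL(2, 𝓞 K)) :
    toGLComplex σ (M * N) = toGLComplex σ M * toGLComplex σ N := by
  simp [toGLComplex]

theorem det_map (σ : K →+* ℂ) (M : SL(2, 𝓞 K)) :
    σ (M 0 0) * σ (M 1 1) - σ (M 0 1) * σ (M 1 0) = 1 := by
  have h := M.det_coe
  rw [Matrix.det_fin_two] at h
  have := congrArg (fun x : 𝓞 K => σ x) h
  simpa using this

/-- The equation of a Bianchi circle. -/
theorem im_eq_zero_of_mem {σ : K →+* ℂ} {M : SL(2, 𝓞 K)} {x : OnePoint ℂ}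
    (hx : x ∈ extendedReals) {z : ℂ} (h : toGLComplex σ M • x = z) :
    ((σ (M 1 1) * z - σ (M 0 1)) * (starRingEnd ℂ) (σ (M 0 0) - σ (M 1 0) * z)).im = 0 := by
  have hdet := det_map σ M
  rcases hx with rfl | ⟨t, rfl⟩
  · rw [OnePoint.smul_infty_eq_ite] at h
    by_cases h0 : toGLComplex σ M 1 0 = 0
    · rw [if_pos h0] at h
      exact absurd h (OnePoint.infty_ne_coe z)
    · rw [if_neg h0, OnePoint.coe_eq_coe, div_eq_iff h0] at h
      simp only [toGLComplex_apply] at h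
      simp [h, mul_comm]
  · rw [OnePoint.smul_some_eq_ite] at h
    by_cases h0 : toGLComplex σ M 1 0 * t + toGLComplex σ M 1 1 = 0
    · rw [if_pos h0] at h
      exact absurd h (OnePoint.infty_ne_coe z)
    · rw [if_neg h0, OnePoint.coe_eq_coe, div_eq_iff h0] at h
      simp only [toGLComplex_apply] at h h0
      set w := σ (M 1 0) * t + σ (M 1 1)
      -- The inverse matrix sends (z, 1) to (t, 1)/w, and t is real.
      have h1 : σ (M 1 1) * z - σ (M 0 1) = t / w := by
        rw [eq_div_iff h0]
        linear_combination -σ (M 1 1) * h + t * hdet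
      have h2 : σ (M 0 0) - σ (M 1 0) * z = 1 / w := by
        rw [eq_div_iff h0]
        linear_combination σ (M 1 0) * h + hdet
      rw [h1, h2, div_eq_mul_inv, one_div, mul_assoc, Complex.mul_conj, ← Complex.ofReal_mul,
        Complex.ofReal_im]

variable [NumberField K]

theorem conj_sqrtDiscr : (starRingEnd ℂ) (sqrtDiscr K) = -sqrtDiscr K := by
  simp [sqrtDiscr]

variable [Algebra.IsQuadraticExtension ℚ K] [NumberField.IsTotallyComplex K]

theorem exists_conj (σ : K →+* ℂ) (x : 𝓞 K) : ∃ y : 𝓞 K, σ y = (starRingEnd ℂ) (σ x) := by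
  obtain ⟨-, -, h1, h2⟩ := ringOfIntegers_coordinates K σ
  obtain ⟨u, v, huv, hx⟩ := h1 x
  obtain ⟨y, hy⟩ := h2 u (-v) (by
    obtain ⟨k, hk⟩ := huv
    exact ⟨k + v * NumberField.discr K, by linear_combination hk⟩)
  refine ⟨y, ?_⟩
  rw [hy, hx]
  simp [conj_sqrtDiscr, map_ofNat]

/-- Conjugation is trivial modulo √Δ. This is the source of the congruence ζ ≡ 1 and of the
integrality of k and m. -/
theorem exists_sub_conj (σ : K →+* ℂ) (x : 𝓞 K) :
    ∃ v : ℤ, σ x - (starRingEnd ℂ) (σ x) = v * sqrtDiscr K := by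
  obtain ⟨-, -, h1, -⟩ := ringOfIntegers_coordinates K σ
  obtain ⟨u, v, -, hx⟩ := h1 x
  refine ⟨v, ?_⟩
  rw [hx]
  simp [conj_sqrtDiscr, map_ofNat]
  ring

/-- The coefficients of the equation of a Bianchi circle. -/
theorem bianchi_coefficients (σ : K →+* ℂ) (M : SL(2, 𝓞 K)) :
    ∃ (k m : ℤ) (η : 𝓞 K),
      Complex.normSq (1 + σ η * sqrtDiscr K) = 1 - k * m * NumberField.discr K ∧
      ∀ x ∈ extendedReals, ∀ z : ℂ, toGLComplex σ M • x = z →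
        k * √(-(NumberField.discr K : ℝ)) * Complex.normSq z +
          2 * ((1 + σ η * sqrtDiscr K) * z).im + m * √(-(NumberField.discr K : ℝ)) = 0 := by
  have hneg := (ringOfIntegers_coordinates K σ).1
  have hδ := sqrtDiscr_mul_self K hneg
  obtain ⟨a', ha'⟩ := exists_conj σ (M 0 0)
  obtain ⟨c', hc'⟩ := exists_conj σ (M 1 0)
  obtain ⟨k, hk⟩ := exists_sub_conj σ (M 1 1 * c')
  obtain ⟨m, hm⟩ := exists_sub_conj σ (M 0 1 * a')
  obtain ⟨α, hα⟩ := exists_sub_conj σ (M 0 0)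
  obtain ⟨β, hβ⟩ := exists_sub_conj σ (M 0 1)
  have hdet := det_map σ M
  have hdet' := congrArg (starRingEnd ℂ) hdet
  simp only [map_mul, map_sub, map_one, ha', hc', Complex.conj_conj] at hk hm hdet'
  -- Replacing the conjugates of a and b by a − α√Δ and b − β√Δ turns ζ = d·conj a − c·conj b into
  -- ad − bc = 1 plus a multiple of √Δ.
  have hζ : 1 + σ ((β * M 1 0 - α * M 1 1 : 𝓞 K) : K) * sqrtDiscr K =
      σ (M 1 1) * (starRingEnd ℂ) (σ (M 0 0)) - (starRingEnd ℂ) (σ (M 0 1)) * σ (M 1 0) := by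
    simp only [map_mul, map_sub, map_intCast]
    linear_combination -hdet + σ (M 1 1) * hα - σ (M 1 0) * hβ
  refine ⟨-k, -m, β * M 1 0 - α * M 1 1, ?_, fun x hx z hz => ?_⟩
  · rw [hζ]
    apply Complex.ofReal_injective
    rw [Complex.normSq_eq_conj_mul_self]
    push_cast
    simp only [map_mul, map_sub, Complex.conj_conj]
    rw [← hδ]
    linear_combination hdet' +
      ((starRingEnd ℂ) (σ (M 0 0)) * (starRingEnd ℂ) (σ (M 1 1)) -
        (starRingEnd ℂ) (σ (M 0 1)) * (starRingEnd ℂ) (σ (M 1 0))) * hdet -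
      (σ (M 0 1) * (starRingEnd ℂ) (σ (M 0 0)) -
        (starRingEnd ℂ) (σ (M 0 1)) * σ (M 0 0)) * hk - k * sqrtDiscr K * hm
  · rw [hζ]
    have h := im_eq_zero_of_mem hx hz
    have h' := Complex.conj_eq_iff_im.2 h
    simp only [map_mul, map_sub, Complex.conj_conj] at h'
    set ζ := σ (M 1 1) * (starRingEnd ℂ) (σ (M 0 0)) - (starRingEnd ℂ) (σ (M 0 1)) * σ (M 1 0)
      with hζdef
    have hE : -k * (z * (starRingEnd ℂ) z) * sqrtDiscr K + (ζ * z - (starRingEnd ℂ) (ζ * z)) -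
        m * sqrtDiscr K = 0 := by
      rw [hζdef]
      simp only [map_mul, map_sub, Complex.conj_conj]
      linear_combination -h' + z * (starRingEnd ℂ) z * hk + hm
    rw [Complex.mul_conj, Complex.sub_conj, sqrtDiscr] at hE
    have := congrArg Complex.im hE
    simp only [Complex.add_im, Complex.sub_im, Complex.mul_im, Complex.mul_re, Complex.neg_re,
      Complex.neg_im, Complex.intCast_re, Complex.intCast_im, Complex.ofReal_re,
      Complex.ofReal_im, Complex.I_re, Complex.I_im, Complex.zero_im] at this
    rw [Complex.mul_im]
    push_cast
    linear_combination this

end GhostCircle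

/-! ### Existence of the ghost circle, and why Bianchi circles miss it -/

section Ghost

variable {K : Type*} [Field K] [NumberField K]

theorem ghostCenter_of_mod_eq_zero (h : NumberField.discr K % 4 = 0) :
    ghostCenter K = 1 / 2 + ((√(-(NumberField.discr K : ℝ)) / 4 : ℝ) : ℂ) * Complex.I := by
  rw [ghostCenter, if_pos h, sqrtDiscr]
  push_cast
  ring

theorem ghostCenter_of_mod_ne_zero (h : NumberField.discr K % 4 ≠ 0) :
    ghostCenter K = 1 / 2 +
      (((NumberField.discr K + 1) / (4 * √(-(NumberField.discr K : ℝ))) : ℝ) : ℂ) * Complex.I := by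
  rw [ghostCenter, if_neg h, sqrtDiscr]
  have : (4 : ℂ) * (Complex.I * (√(-(NumberField.discr K : ℝ)) : ℂ)) =
      Complex.I * (4 * (√(-(NumberField.discr K : ℝ)) : ℂ)) := by ring
  rw [this, ← div_div, Complex.div_I]
  push_cast
  ring

theorem ghostCenter_re : (ghostCenter K).re = 1 / 2 := by
  by_cases h : NumberField.discr K % 4 = 0
  · simp [ghostCenter_of_mod_eq_zero h]
  · simp [ghostCenter_of_mod_ne_zero h, -Complex.ofReal_div]

theorem ghostCenter_im_of_mod_eq_zero (h : NumberField.discr K % 4 = 0) :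
    (ghostCenter K).im = √(-(NumberField.discr K : ℝ)) / 4 := by
  simp [ghostCenter_of_mod_eq_zero h]

theorem ghostCenter_im_of_mod_eq_one (h : NumberField.discr K % 4 = 1)
    (hneg : NumberField.discr K < 0) :
    √(-(NumberField.discr K : ℝ)) * (ghostCenter K).im = (NumberField.discr K + 1) / 4 := by
  have hpos : 0 < √(-(NumberField.discr K : ℝ)) := Real.sqrt_pos.2 (by
    have : (NumberField.discr K : ℝ) < 0 := by exact_mod_cast hneg
    linarith)
  have : (ghostCenter K).im =
      (NumberField.discr K + 1) / (4 * √(-(NumberField.discr K : ℝ))) := by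
    simp [ghostCenter_of_mod_ne_zero (K := K) (by omega), -Complex.ofReal_div]
  rw [this]
  field_simp

theorem sq_sqrt_neg_discr (hneg : NumberField.discr K < 0) :
    √(-(NumberField.discr K : ℝ)) ^ 2 = -(NumberField.discr K : ℝ) :=
  Real.sq_sqrt (by
    have : (NumberField.discr K : ℝ) < 0 := by exact_mod_cast hneg
    linarith)

theorem one_lt_normSq_ghostCenter (hd : NumberField.discr K < -12)
    (hmod : NumberField.discr K % 4 = 0 ∨ NumberField.discr K % 4 = 1) :
    1 < Complex.normSq (ghostCenter K) := by
  have hs := sq_sqrt_neg_discr (K := K) (by omega)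
  rw [Complex.normSq_apply, ghostCenter_re]
  rcases hmod with h | h
  · rw [ghostCenter_im_of_mod_eq_zero h]
    have : (NumberField.discr K : ℝ) < -12 := by exact_mod_cast hd
    linarith
  · have him := ghostCenter_im_of_mod_eq_one h (by omega)
    -- The inequality amounts to |Δ|² − 14|Δ| + 1 > 0, which fails at 13; the congruence modulo 4
    -- excludes −13 and −14.
    have hd' : (NumberField.discr K : ℝ) ≤ -15 := by
      have : NumberField.discr K ≤ -15 := by omega
      exact_mod_cast this
    have h1 : -(NumberField.discr K : ℝ) * ((ghostCenter K).im * (ghostCenter K).im) =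
        ((NumberField.discr K + 1) / 4) ^ 2 := by
      rw [← hs, ← him]; ring
    by_contra! hcon
    nlinarith

theorem isGhostCircle (h : 1 < Complex.normSq (ghostCenter K)) :
    IsGhostCircle K ⟨ghostCenter K, √(Complex.normSq (ghostCenter K) - 1)⟩ := by
  set c := ghostCenter K
  set r := √(Complex.normSq c - 1)
  have hr : 0 < r := Real.sqrt_pos.2 (by linarith)
  have hr2 : r ^ 2 = Complex.normSq c - 1 := Real.sq_sqrt (by linarith)
  refine ⟨hr, rfl, ?_, ?_⟩
  · have hc : c ≠ 0 := by
      intro hc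
      rw [hc, map_zero] at h
      linarith
    have hn : Complex.normSq (1 + r * Complex.I) = Complex.normSq c := by
      rw [eq_sub_iff_add_eq'] at hr2
      rw [← hr2]
      simp [Complex.normSq_apply]
      ring
    have hnp : 0 < Complex.normSq c := by linarith
    have hcc : (starRingEnd ℂ) c ≠ 0 := by simpa using hc
    have hn' : (1 + r * Complex.I) * (1 - r * Complex.I) = c * (starRingEnd ℂ) c := by
      rw [Complex.mul_conj, ← hn, ← Complex.mul_conj]
      simp [sub_eq_add_neg]
    -- This p has modulus 1 because |1 + ri| = |c|, and it satisfies p − c = irp, so its distance to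
    -- c is r.
    refine ⟨(1 + r * Complex.I) / (starRingEnd ℂ) c, ?_, ?_⟩
    · rw [EuclideanGeometry.mem_sphere, Complex.dist_eq]
      have : (1 + r * Complex.I) / (starRingEnd ℂ) c - c =
          r * (Complex.I * ((1 + r * Complex.I) / (starRingEnd ℂ) c)) := by
        field_simp
        linear_combination hn'
      rw [this, norm_mul, norm_mul, norm_div, Complex.norm_I, one_mul, Complex.norm_conj,
        Complex.norm_def, Complex.norm_def, Complex.norm_def, hn,
        div_self (Real.sqrt_pos.2 hnp).ne', mul_one, ← Complex.norm_def, Complex.norm_real,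
        Real.norm_of_nonneg hr.le]
    · rw [EuclideanGeometry.mem_sphere, Complex.dist_eq, sub_zero, norm_div, Complex.norm_conj,
        Complex.norm_def, Complex.norm_def, hn, div_self (Real.sqrt_pos.2 hnp).ne']
  · intro p hp hp1
    rw [EuclideanGeometry.mem_sphere, Complex.dist_eq] at hp hp1
    have hp' := congrArg (· ^ 2) hp
    have hp1' := congrArg (· ^ 2) hp1
    simp only [Complex.sq_norm, hr2] at hp' hp1'
    rw [Complex.inner]
    simp [Complex.normSq_apply] at hp' hp1' ⊢
    linarith

variable [Algebra.IsQuadraticExtension ℚ K] [NumberField.IsTotallyComplex K]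

/-- A common point would bound the inversive product by 1. Integrality makes the product at least as
large in absolute value as for the real line, which the ghost circle misses because r² = (Im c)² −
3/4. -/
theorem normSq_sub_ghostCenter_ne (hd : NumberField.discr K < -12) (σ : K →+* ℂ)
    (M : SL(2, 𝓞 K)) {x : OnePoint ℂ} (hx : x ∈ extendedReals) {z : ℂ}
    (hz : toGLComplex σ M • x = z) :
    Complex.normSq (z - ghostCenter K) ≠ Complex.normSq (ghostCenter K) - 1 := by
  intro hG
  obtain ⟨k, m, η, hn, hE⟩ := bianchi_coefficients σ M
  have hE := hE x hx z hz
  obtain ⟨hneg, hmod, h1, -⟩ := ringOfIntegers_coordinates K σ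
  obtain ⟨e, f, ⟨j, hj⟩, hη⟩ := h1 η
  have hs := sq_sqrt_neg_discr hneg
  have hre : (1 + σ η * sqrtDiscr K).re = 1 + f * NumberField.discr K / 2 := by
    rw [hη, show 1 + (e + f * sqrtDiscr K) / 2 * sqrtDiscr K =
      1 + e / 2 * sqrtDiscr K + f / 2 * (sqrtDiscr K * sqrtDiscr K) by ring,
      sqrtDiscr_mul_self K hneg]
    simp [sqrtDiscr]
    ring
  have him : (1 + σ η * sqrtDiscr K).im = e / 2 * √(-(NumberField.discr K : ℝ)) := by
    rw [hη, show 1 + (e + f * sqrtDiscr K) / 2 * sqrtDiscr K =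
      1 + e / 2 * sqrtDiscr K + f / 2 * (sqrtDiscr K * sqrtDiscr K) by ring,
      sqrtDiscr_mul_self K hneg]
    simp [sqrtDiscr]
  rw [Complex.normSq_apply, hre, him] at hn
  rw [Complex.mul_im, hre, him, Complex.normSq_apply] at hE
  have hj' : (e : ℝ) = f * NumberField.discr K + 2 * j := by
    have : e = f * NumberField.discr K + 2 * j := by linarith
    exact_mod_cast this
  simp only [Complex.normSq_apply, Complex.sub_re, Complex.sub_im] at hG
  set s := √(-(NumberField.discr K : ℝ))
  set Δ := NumberField.discr K
  have key := inversive_product_sq_le (k := k) (m := m) (s := s) (p := 1 + f * Δ / 2)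
    (q := e / 2 * s) (x := z.re) (y := z.im) (c₁ := (ghostCenter K).re)
    (c₂ := (ghostCenter K).im) (by rw [hs]; linarith) (by linarith) (by linarith)
  rw [ghostCenter_re] at key
  rcases hmod with h | h
  · obtain ⟨t, ht⟩ : ∃ t, Δ = 4 * t := ⟨Δ / 4, by omega⟩
    rw [ghostCenter_im_of_mod_eq_zero h] at key
    -- The left side of `key` is the square of s/2 times the odd integer 2W + 1, hence at least
    -- s²/4; the right side is s²/4 − 3.
    obtain ⟨W, hW⟩ : ∃ W : ℤ, W = 3 * f * t + j + k + m := ⟨_, rfl⟩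
    have hW1 : (1 : ℝ) ≤ (2 * W + 1) ^ 2 := by
      have : (1 : ℤ) ≤ (2 * W + 1) ^ 2 := by nlinarith [Int.le_self_sq (-W)]
      exact_mod_cast this
    have ht' : (Δ : ℝ) = 4 * t := by exact_mod_cast ht
    have hW' : (W : ℝ) = 3 * f * t + j + k + m := by exact_mod_cast hW
    have h2 : 2 * ((1 + f * Δ / 2) * (s / 4) + e / 2 * s * (1 / 2)) + (k + m) * s =
        s / 2 * (2 * W + 1) := by
      rw [hj', hW', ht']
      ring
    change (2 * ((1 + f * Δ / 2) * (s / 4) + e / 2 * s * (1 / 2)) + (k + m) * s) ^ 2 ≤ _ at key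
    rw [h2] at key
    nlinarith [sq_nonneg s, mul_nonneg (sq_nonneg s) (sub_nonneg.2 hW1)]
  · obtain ⟨t, ht⟩ : ∃ t, Δ = 4 * t + 1 := ⟨Δ / 4, by omega⟩
    have hc := ghostCenter_im_of_mod_eq_one h hneg
    -- After multiplication by s², the left side of `key` is (1 + Δ(2w + 1))²/4. By `hw1` it is at
    -- least its value (1 + Δ)²/4 at w = 0, while the right side is (1 + Δ)²/4 + 3Δ.
    obtain ⟨w, hw⟩ : ∃ w : ℤ, w = -(t * f) - (j + k + m) := ⟨_, rfl⟩
    have hw1 : (0 : ℝ) ≤ (Δ * w) * (1 + Δ * (w + 1)) := by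
      have : 0 ≤ (Δ * w) * (1 + Δ * (w + 1)) := by
        rcases le_or_gt 0 w with h0 | h0
        · exact mul_nonneg_of_nonpos_of_nonpos (by nlinarith) (by nlinarith)
        · exact mul_nonneg (by nlinarith) (by nlinarith)
      exact_mod_cast this
    have hw' : (w : ℝ) = -(t * f) - (j + k + m) := by exact_mod_cast hw
    have ht' : (Δ : ℝ) = 4 * t + 1 := by exact_mod_cast ht
    set y := (ghostCenter K).im
    have h2 : s * (2 * ((1 + f * Δ / 2) * y + e / 2 * s * (1 / 2)) + (k + m) * s) =
        (1 + Δ * (2 * w + 1)) / 2 := by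
      rw [hj', hw']
      linear_combination (2 + f * Δ) * hc + (k + m + (f * Δ + 2 * j) / 2) * hs -
        f * Δ / 4 * ht'
    have h3 := mul_le_mul_of_nonneg_left key (sq_nonneg s)
    rw [← mul_pow, h2] at h3
    have h4 : s ^ 2 * (4 * ((1 / 2) ^ 2 + y ^ 2 - 1)) = 3 * Δ + (Δ + 1) ^ 2 / 4 := by
      rw [show s ^ 2 * (4 * ((1 / 2) ^ 2 + y ^ 2 - 1)) = 4 * (s * y) ^ 2 - 3 * s ^ 2 by ring, hc,
        hs]
      ring
    rw [h4] at h3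
    have : (Δ : ℝ) < 0 := by exact_mod_cast hneg
    nlinarith

end Ghost

/-! ### Euclidean rings have connected arrangements -/

section Connected

open Filter Topology

/-- Möbius transformations are continuous on the Riemann sphere. -/
theorem continuous_moebius (g : GL (Fin 2) ℂ) : Continuous fun z : OnePoint ℂ => g • z := by
  have hdet : g 0 0 * g 1 1 - g 0 1 * g 1 0 ≠ 0 := by
    rw [← Matrix.det_fin_two]
    exact g.det_ne_zero
  have hcoe {l : Filter ℂ} {f : ℂ → ℂ} (h : Tendsto f l (Bornology.cobounded ℂ)) :
      Tendsto (fun z => (f z : OnePoint ℂ)) l (𝓝 ∞) := by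
    refine OnePoint.tendsto_coe_infty.comp ?_
    rwa [coclosedCompact_eq_cocompact, ← Metric.cobounded_eq_cocompact]
  rw [OnePoint.continuous_iff, coclosedCompact_eq_cocompact, ← Metric.cobounded_eq_cocompact]
  constructor
  · by_cases hc : g 1 0 = 0
    · have hd : g 1 1 ≠ 0 := by rintro h; simp [hc, h] at hdet
      have ha : g 0 0 ≠ 0 := by rintro h; simp [hc, h] at hdet
      rw [OnePoint.smul_infty_eq_ite, if_pos hc]
      have heq (z : ℂ) : g • (z : OnePoint ℂ) = ((g 0 0 / g 1 1 * z + g 0 1 / g 1 1 : ℂ)) := by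
        rw [OnePoint.smul_some_eq_ite, hc, zero_mul, zero_add, if_neg hd]
        congr 1
        ring
      simp only [heq]
      refine hcoe ?_
      refine tendsto_add_const_cobounded _ |>.comp ?_
      exact Filter.tendsto_mul_left_cobounded (div_ne_zero ha hd)
    · rw [OnePoint.smul_infty_eq_ite, if_neg hc]
      have hw : Tendsto (fun z : ℂ => g 1 0 * z + g 1 1) (Bornology.cobounded ℂ)
          (Bornology.cobounded ℂ) :=
        (tendsto_add_const_cobounded _).comp (Filter.tendsto_mul_left_cobounded hc)
      have hne : ∀ᶠ z in Bornology.cobounded ℂ, g 1 0 * z + g 1 1 ≠ 0 :=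
        hw.eventually_ne_cobounded 0
      -- In this form z occurs only in (cz + d)⁻¹, which tends to 0.
      have heq : (fun z : ℂ => g • (z : OnePoint ℂ)) =ᶠ[Bornology.cobounded ℂ] fun z =>
          ((g 0 0 / g 1 0 - (g 0 0 * g 1 1 - g 0 1 * g 1 0) / g 1 0 * (g 1 0 * z + g 1 1)⁻¹ : ℂ) :
            OnePoint ℂ) := by
        filter_upwards [hne] with z hz
        rw [OnePoint.smul_some_eq_ite, if_neg hz]
        congr 1
        rw [div_eq_iff hz, sub_mul, mul_assoc, inv_mul_cancel₀ hz]
        field_simp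
        ring
      refine Tendsto.congr' heq.symm ((OnePoint.continuous_coe.tendsto _).comp ?_)
      simpa using tendsto_const_nhds.sub
        ((tendsto_inv₀_cobounded.comp hw).const_mul ((g 0 0 * g 1 1 - g 0 1 * g 1 0) / g 1 0))
  · rw [continuous_iff_continuousAt]
    intro z₀
    have hden : ContinuousAt (fun z : ℂ => g 1 0 * z + g 1 1) z₀ := by fun_prop
    have hnum : ContinuousAt (fun z : ℂ => g 0 0 * z + g 0 1) z₀ := by fun_prop
    by_cases h0 : g 1 0 * z₀ + g 1 1 = 0
    · have hc : g 1 0 ≠ 0 := by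
        intro hc
        have hd : g 1 1 = 0 := by simpa [hc] using h0
        simp [hc, hd] at hdet
      have hn0 : g 0 0 * z₀ + g 0 1 ≠ 0 := by
        intro hn
        apply hdet
        apply mul_left_cancel₀ hc
        linear_combination g 1 0 * g 0 0 * h0 - g 1 0 * g 1 0 * hn
      rw [continuousAt_iff_punctured_nhds, OnePoint.smul_some_eq_ite, if_pos h0]
      have hne {z : ℂ} (hz : z ≠ z₀) : g 1 0 * z + g 1 1 ≠ 0 := by
        intro h
        apply hz
        apply mul_left_cancel₀ hc
        linear_combination h - h0
      have hev : ∀ᶠ z in 𝓝[≠] z₀, z ≠ z₀ := eventually_mem_nhdsWithin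
      have heq : (fun z : ℂ => g • (z : OnePoint ℂ)) =ᶠ[𝓝[≠] z₀] fun z =>
          (((g 0 0 * z + g 0 1) * (g 1 0 * z + g 1 1)⁻¹ : ℂ) : OnePoint ℂ) := by
        filter_upwards [hev] with z hz
        rw [OnePoint.smul_some_eq_ite, if_neg (hne hz), div_eq_mul_inv]
      refine Tendsto.congr' heq.symm (hcoe ?_)
      rw [← tendsto_norm_atTop_iff_cobounded]
      simp only [norm_mul]
      refine Tendsto.pos_mul_atTop (norm_pos_iff.2 hn0)
        (hnum.norm.tendsto.mono_left nhdsWithin_le_nhds) ?_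
      rw [tendsto_norm_atTop_iff_cobounded]
      refine tendsto_inv₀_nhdsNE_zero.comp (tendsto_nhdsWithin_iff.2 ⟨?_, ?_⟩)
      · have := hden.tendsto.mono_left (nhdsWithin_le_nhds (s := {z₀}ᶜ))
        rwa [h0] at this
      · filter_upwards [hev] with z hz using hne hz
    · have heq : (fun z : ℂ => g • (z : OnePoint ℂ)) =ᶠ[𝓝 z₀] fun z =>
          (((g 0 0 * z + g 0 1) / (g 1 0 * z + g 1 1) : ℂ) : OnePoint ℂ) := by
        filter_upwards [hden.eventually_ne h0] with z hz
        rw [OnePoint.smul_some_eq_ite, if_neg hz]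
      exact ContinuousAt.congr
        (OnePoint.continuous_coe.continuousAt.comp (hnum.div hden h0)) heq.symm

theorem infty_mem_extendedReals : ∞ ∈ extendedReals := Set.mem_insert _ _

theorem isPreconnected_extendedReals : IsPreconnected extendedReals := by
  have h1 : IsPreconnected (Set.range fun x : ℝ => ((x : ℂ) : OnePoint ℂ)) :=
    isPreconnected_range (OnePoint.continuous_coe.comp Complex.continuous_ofReal)
  refine h1.subset_closure (Set.subset_insert _ _) (Set.insert_subset ?_ subset_closure)
  have h2 : Tendsto (fun n : ℕ => (((n : ℝ) : ℂ) : OnePoint ℂ)) atTop (𝓝 ∞) := by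
    refine OnePoint.tendsto_coe_infty.comp ?_
    rw [coclosedCompact_eq_cocompact, ← Metric.cobounded_eq_cocompact,
      ← tendsto_norm_atTop_iff_cobounded]
    simpa using tendsto_natCast_atTop_atTop (R := ℝ)
  exact mem_closure_of_tendsto h2 (Eventually.of_forall fun n => ⟨n, rfl⟩)

variable {K : Type*} [Field K] (σ : K →+* ℂ)

/-- The Bianchi circle of a matrix. -/
def bianchiCircle (M : SL(2, 𝓞 K)) : Set (OnePoint ℂ) :=
  (fun z => toGLComplex σ M • z) '' extendedReals

theorem isPreconnected_bianchiCircle (M : SL(2, 𝓞 K)) : IsPreconnected (bianchiCircle σ M) :=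
  isPreconnected_extendedReals.image _ (continuous_moebius _).continuousOn

theorem bianchiCircle_subset_arrangement (M : SL(2, 𝓞 K)) :
    bianchiCircle σ M ⊆ arrangement σ :=
  Set.subset_sUnion_of_mem ⟨M, rfl⟩

/-- Translation by `l`, as a matrix. -/
def translation (l : 𝓞 K) : SL(2, 𝓞 K) := ⟨!![1, l; 0, 1], by simp⟩

/-- The matrix of the Möbius transformation `z ↦ -1 / z`. -/
def inversion : SL(2, 𝓞 K) := ⟨!![0, -1; 1, 0], by simp⟩

theorem translation_smul_infty (l : 𝓞 K) :
    toGLComplex σ (translation l) • (∞ : OnePoint ℂ) = ∞ := by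
  rw [OnePoint.smul_infty_eq_self_iff, toGLComplex_apply]
  simp [translation]

theorem translation_smul_coe (l : 𝓞 K) (z : ℂ) :
    toGLComplex σ (translation l) • (z : OnePoint ℂ) = ((z + σ l : ℂ) : OnePoint ℂ) := by
  rw [OnePoint.smul_some_eq_ite]
  simp only [toGLComplex_apply]
  simp [translation]

theorem infty_mem_arrangement : ∞ ∈ arrangement σ := by
  refine bianchiCircle_subset_arrangement σ 1 ⟨∞, infty_mem_extendedReals, ?_⟩
  simp [toGLComplex]

theorem bianchiCircle_subset_component {M : SL(2, 𝓞 K)} {p : OnePoint ℂ}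
    (hp : p ∈ bianchiCircle σ M) (hp' : p ∈ connectedComponentIn (arrangement σ) ∞) :
    bianchiCircle σ M ⊆ connectedComponentIn (arrangement σ) ∞ := by
  rw [connectedComponentIn_eq hp']
  exact (isPreconnected_bianchiCircle σ M).subset_connectedComponentIn hp
    (bianchiCircle_subset_arrangement σ M)

theorem smul_infty_mem_bianchiCircle (M : SL(2, 𝓞 K)) :
    toGLComplex σ M • (∞ : OnePoint ℂ) ∈ bianchiCircle σ M :=
  ⟨∞, infty_mem_extendedReals, rfl⟩

/-- Keeps only what the chain of circles needs: division with a remainder that descends, not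
necessarily for a norm. -/
theorem IsEuclidean.exists_wellFounded {R : Type*} [CommRing R] (h : IsEuclidean R) :
    ∃ r : R → R → Prop, WellFounded r ∧ ∀ d c : R, c ≠ 0 → ∃ q, r (d - c * q) c := by
  rename_i inst
  obtain ⟨E, hE⟩ := h
  change E.toCommRing = inst at hE
  subst hE
  refine ⟨E.r, E.r_wellFounded, fun d c hc => ⟨E.quotient d c, ?_⟩⟩
  have h1 := E.quotient_mul_add_remainder_eq d c
  have h2 := E.remainder_lt d hc
  rwa [← sub_eq_of_eq_add' h1.symm] at h2

/-- The arrangement of a Euclidean ring is connected. -/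
theorem isConnected_arrangement (h : IsEuclidean (𝓞 K)) : IsConnected (arrangement σ) := by
  obtain ⟨r, hwf, hdiv⟩ := h.exists_wellFounded
  have key (c : 𝓞 K) : ∀ M : SL(2, 𝓞 K), M 1 0 = c →
      bianchiCircle σ M ⊆ connectedComponentIn (arrangement σ) ∞ := by
    induction c using hwf.induction with
    | _ c ih =>
      intro M hM
      by_cases hc : c = 0
      · refine bianchiCircle_subset_component σ (smul_infty_mem_bianchiCircle σ M) ?_
        rw [OnePoint.smul_infty_eq_self_iff.2]
        · exact mem_connectedComponentIn (infty_mem_arrangement σ)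
        · rw [toGLComplex_apply, hM, hc]
          simp
      -- The new matrix has lower left entry d − cq and sends 0 to the image of ∞ under M, so the
      -- two circles share that point.
      · obtain ⟨q, hq⟩ := hdiv (M 1 1) c hc
        have hsub := ih _ hq (M * translation (-q) * inversion) (by
          rw [Matrix.SpecialLinearGroup.coe_mul, Matrix.SpecialLinearGroup.coe_mul]
          simp [Matrix.mul_apply, Fin.sum_univ_two, translation, inversion, hM]
          ring)
        refine bianchiCircle_subset_component σ (smul_infty_mem_bianchiCircle σ M) (hsub ?_)
        refine ⟨((0 : ℝ) : ℂ), Or.inr ⟨0, rfl⟩, ?_⟩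
        have : toGLComplex σ (inversion : SL(2, 𝓞 K)) • (((0 : ℝ) : ℂ) : OnePoint ℂ) = ∞ := by
          simp only [OnePoint.smul_some_eq_ite, toGLComplex_apply]
          simp [inversion]
        simp only [toGLComplex_mul, mul_smul, this, translation_smul_infty]
  refine ⟨⟨∞, infty_mem_arrangement σ⟩, ?_⟩
  have : arrangement σ = connectedComponentIn (arrangement σ) ∞ := by
    refine subset_antisymm ?_ (connectedComponentIn_subset _ _)
    rintro p ⟨_, ⟨M, rfl⟩, hp⟩
    exact key _ M rfl hp
  rw [this]
  exact isPreconnected_connectedComponentIn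

end Connected

/-! ### Covering radius, norm-Euclidean fields and density -/

section Covering

variable {K : Type*} [Field K] [NumberField K] [Algebra.IsQuadraticExtension ℚ K]
  [NumberField.IsTotallyComplex K]

/-- The covering radius of the ring of integers is bounded. -/
theorem exists_normSq_sub_le (σ : K →+* ℂ) (z : ℂ) :
    ∃ q : 𝓞 K, Complex.normSq (z - σ q) ≤ 1 / 4 - NumberField.discr K / 16 := by
  obtain ⟨hneg, -, -, h2⟩ := ringOfIntegers_coordinates K σ
  have hs := sq_sqrt_neg_discr hneg
  have hpos : 0 < √(-(NumberField.discr K : ℝ)) := Real.sqrt_pos.2 (by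
    have : (NumberField.discr K : ℝ) < 0 := by exact_mod_cast hneg
    linarith)
  -- The lattice consists of horizontal rows √|Δ|/2 apart: v picks the nearest row and j the nearest
  -- point in it. The errors are at most √|Δ|/4 and 1/2.
  set v := round (2 * z.im / √(-(NumberField.discr K : ℝ))) with hv
  set j := round (z.re - v * NumberField.discr K / 2) with hj
  obtain ⟨q, hq⟩ := h2 (v * NumberField.discr K + 2 * j) v ⟨j, by ring⟩
  refine ⟨q, ?_⟩
  have h1 := abs_le.1 (abs_sub_round (2 * z.im / √(-(NumberField.discr K : ℝ))))
  have h2 := abs_le.1 (abs_sub_round (z.re - v * NumberField.discr K / 2))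
  rw [← hv] at h1
  rw [← hj] at h2
  have hre : (z - σ q).re = z.re - v * NumberField.discr K / 2 - j := by
    rw [hq]
    simp [sqrtDiscr]
    ring
  have him : (z - σ q).im = (2 * z.im / √(-(NumberField.discr K : ℝ)) - v) *
      (√(-(NumberField.discr K : ℝ)) / 2) := by
    rw [hq]
    simp [sqrtDiscr]
    field_simp
  have hsq {t : ℝ} (h : -(1 / 2) ≤ t ∧ t ≤ 1 / 2) : t ^ 2 ≤ 1 / 4 := by nlinarith [h.1, h.2]
  have h3 := hsq h1
  have h4 := hsq h2
  rw [Complex.normSq_apply, ← sq, ← sq, hre, him, mul_pow, div_pow, hs]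
  have h5 : (NumberField.discr K : ℝ) < 0 := by exact_mod_cast hneg
  nlinarith

/-- The product of x with its conjugate is a real lattice point, hence an integer. This supplies the
Euclidean function. -/
theorem exists_natCast_eq_normSq (σ : K →+* ℂ) (x : 𝓞 K) :
    ∃ n : ℕ, (n : ℝ) = Complex.normSq (σ x) := by
  obtain ⟨y, hy⟩ := exists_conj σ x
  obtain ⟨hneg, -, h1, -⟩ := ringOfIntegers_coordinates K σ
  obtain ⟨u, v, ⟨k, hk⟩, hu⟩ := h1 (x * y)
  have hn : σ ((x * y : 𝓞 K) : K) = (Complex.normSq (σ x) : ℂ) := by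
    rw [← Complex.mul_conj, ← hy]
    simp
  have hpos : 0 < √(-(NumberField.discr K : ℝ)) := Real.sqrt_pos.2 (by
    have : (NumberField.discr K : ℝ) < 0 := by exact_mod_cast hneg
    linarith)
  rw [hn] at hu
  have hre := congrArg Complex.re hu
  have him := congrArg Complex.im hu
  simp [sqrtDiscr] at hre him
  have hv : v = 0 := by simpa [hpos.ne'] using him.symm
  rw [hv, zero_mul, sub_zero] at hk
  have hk' : Complex.normSq (σ x) = k := by
    rw [hre, hk]
    push_cast
    ring
  have hk0 : 0 ≤ k := by
    have := Complex.normSq_nonneg (σ x)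
    rw [hk'] at this
    exact_mod_cast this
  lift k to ℕ using hk0
  exact ⟨k, by rw [hk']; simp⟩

/-- The ring of integers is norm-Euclidean if the discriminant is small. -/
theorem isEuclidean_of_discr (σ : K →+* ℂ) (hd : -12 < NumberField.discr K) :
    IsEuclidean (𝓞 K) := by
  classical
  choose N hN using exists_natCast_eq_normSq σ
  have hinj (x : 𝓞 K) (hx : x ≠ 0) : σ x ≠ 0 := by simpa using hx
  -- The clause for b = 0 serves the field `quotient_zero`.
  have hdiv (a b : 𝓞 K) : ∃ q : 𝓞 K, (b = 0 → q = 0) ∧ (b ≠ 0 → N (a - b * q) < N b) := by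
    by_cases hb : b = 0
    · exact ⟨0, fun _ => rfl, fun h => absurd hb h⟩
    · obtain ⟨q, hq⟩ := exists_normSq_sub_le σ (σ a / σ b)
      refine ⟨q, fun h => absurd h hb, fun _ => ?_⟩
      have hd' : (-12 : ℝ) < NumberField.discr K := by exact_mod_cast hd
      have h1 : Complex.normSq (σ a / σ b - σ q) < 1 := by linarith
      have h2 : σ ((a - b * q : 𝓞 K) : K) = σ b * (σ a / σ b - σ q) := by
        have := hinj b hb
        simp only [map_sub, map_mul]
        field_simp
      have h3 : (N (a - b * q) : ℝ) < N b := by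
        rw [hN, hN, h2, map_mul]
        exact mul_lt_of_lt_one_right (Complex.normSq_pos.2 (hinj b hb)) h1
      exact_mod_cast h3
  choose Q hQ0 hQ using hdiv
  refine ⟨{ (inferInstance : CommRing (𝓞 K)), (inferInstance : Nontrivial (𝓞 K)) with
    quotient := Q
    quotient_zero := fun a => hQ0 a 0 rfl
    remainder := fun a b => a - b * Q a b
    quotient_mul_add_remainder_eq := fun a b => by ring
    r := fun a b => N a < N b
    r_wellFounded := (measure N).wf
    remainder_lt := fun a b hb => hQ a b hb
    mul_left_not_lt := fun a b hb => by
      rw [not_lt]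
      have h1 : 1 ≤ N b := by
        have : (0 : ℝ) < N b := by
          rw [hN]
          exact Complex.normSq_pos.2 (hinj b hb)
        exact_mod_cast this
      have h2 : (N (a * b) : ℝ) = N a * N b := by
        rw [hN, hN, hN]
        simp
      have h3 : N (a * b) = N a * N b := by exact_mod_cast h2
      rw [h3]
      exact Nat.le_mul_of_pos_right _ h1 }, rfl⟩

/-- The arrangement is dense. -/
theorem exists_mem_ball_mem_arrangement (σ : K →+* ℂ) (c : ℂ) {r : ℝ} (hr : 0 < r) :
    ∃ z ∈ Metric.ball c r, (z : OnePoint ℂ) ∈ arrangement σ := by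
  set B : ℝ := √(1 / 4 - NumberField.discr K / 16)
  obtain ⟨n, hn⟩ := exists_nat_gt ((1 + B) / r)
  have hn0 : (0 : ℝ) < n := lt_of_le_of_lt (by positivity) hn
  have hn1 : (1 : ℝ) ≤ n := by
    have : 0 < n := by exact_mod_cast hn0
    exact_mod_cast this
  have hnC : (n : ℂ) ≠ 0 := by exact_mod_cast hn0.ne'
  obtain ⟨β, hβ⟩ := exists_normSq_sub_le σ (n * c)
  have hβ' : ‖n * c - σ β‖ ≤ B := Real.le_sqrt_of_sq_le (by rwa [Complex.sq_norm])
  -- A parabolic element fixing β/n. It sends ∞ to β/n + 1/n², at distance at most (1 + B)/n from c,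
  -- whether or not β/n is itself an image of ∞.
  let M : SL(2, 𝓞 K) := ⟨!![1 + n * β, -β ^ 2; n ^ 2, 1 - n * β], by
    rw [Matrix.det_fin_two_of]; ring⟩
  refine ⟨(1 + n * σ β) / n ^ 2, ?_, bianchiCircle_subset_arrangement σ M ?_⟩
  · rw [Metric.mem_ball, Complex.dist_eq]
    have h1 : (1 + n * σ β) / n ^ 2 - c = (1 / n - (n * c - σ β)) / n := by
      field_simp
      ring
    rw [h1, norm_div, Complex.norm_natCast, div_lt_iff₀ hn0]
    rw [div_lt_iff₀ hr] at hn
    calc ‖(1 / n - (n * c - σ β) : ℂ)‖ ≤ ‖(1 / n : ℂ)‖ + ‖n * c - σ β‖ := norm_sub_le _ _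
      _ ≤ 1 + B := by
        gcongr
        rw [norm_div, norm_one, Complex.norm_natCast, div_le_one hn0]
        exact hn1
      _ < r * n := by linarith
  · have h := smul_infty_mem_bianchiCircle σ M
    rw [OnePoint.smul_infty_eq_ite, if_neg] at h
    · simp only [toGLComplex_apply] at h
      simpa [M] using h
    · rw [toGLComplex_apply]
      simpa [M] using fun h : (n : K) = 0 => hnC (by rw [← map_natCast σ, h, map_zero])

end Covering

/-! ### Counting components with separating circles -/

section Components

theorem isOpen_inside (c : ℂ) (r : ℝ) : IsOpen (inside c r) :=
  OnePoint.isOpen_image_coe.2 Metric.isOpen_ball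

theorem isOpen_outside (c : ℂ) (r : ℝ) : IsOpen (outside c r) :=
  OnePoint.isOpen_compl_image_coe.2 ⟨Metric.isClosed_closedBall, isCompact_closedBall c r⟩

theorem compl_inside_diff_circle (c : ℂ) (r : ℝ) : (inside c r)ᶜ \ circle c r = outside c r := by
  rw [inside, circle, outside, ← Metric.ball_union_sphere, Set.image_union, Set.compl_union,
    Set.sdiff_eq]

/-- A circle disjoint from a subset of the sphere cuts it into two relatively clopen parts. -/
theorem isClopen_preimage_inside {S : Set (OnePoint ℂ)} {c : ℂ} {r : ℝ}
    (h : Disjoint S (circle c r)) : IsClopen ((↑) ⁻¹' inside c r : Set S) := by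
  refine ⟨⟨?_⟩, (isOpen_inside c r).preimage continuous_subtype_val⟩
  have : ((↑) ⁻¹' inside c r : Set S)ᶜ = (↑) ⁻¹' outside c r := by
    ext ⟨p, hp⟩
    have := Set.disjoint_left.1 h hp
    simp [← compl_inside_diff_circle, this]
  rw [this]
  exact (isOpen_outside c r).preimage continuous_subtype_val

/-- Each interior is clopen in S, so no component leaves it; points chosen in disjoint interiors lie
in different components. -/
theorem infinite_connectedComponents {ι : Type*} {S : Set (OnePoint ℂ)} {c : ι → ℂ} {r : ℝ}
    {L : Set ι} (hL : L.Infinite) (hd : L.PairwiseDisjoint fun l => inside (c l) r)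
    (h : ∀ l, Disjoint S (circle (c l) r)) (hne : ∀ l, (S ∩ inside (c l) r).Nonempty) :
    Infinite (ConnectedComponents S) := by
  choose p hpS hp using hne
  have := hL.to_subtype
  refine Infinite.of_injective
    (fun l : L => ((⟨p l, hpS l⟩ : S) : ConnectedComponents S)) fun l l' hll => ?_
  have h1 := ConnectedComponents.coe_eq_coe'.1 hll
  have h2 := (isClopen_preimage_inside (h l')).connectedComponent_subset (hp l') h1
  by_contra hne
  exact Set.disjoint_left.1 (hd l.2 l'.2 fun h => hne (Subtype.ext h)) (hp l) h2

theorem exists_infinite_pairwiseDisjoint_inside {K : Type*} [Field K] [NumberField K]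
    (σ : K →+* ℂ) (c : ℂ) (r : ℝ) :
    ∃ L : Set (𝓞 K), L.Infinite ∧ L.PairwiseDisjoint fun l => inside (c + σ l) r := by
  -- Translations by multiples of n move centres by more than a diameter; the 0 keeps n positive
  -- when r ≤ 0.
  obtain ⟨n, hn⟩ := exists_nat_gt (max 0 (2 * r))
  have hn0 : (0 : ℝ) < n := (le_max_left _ _).trans_lt hn
  have hn1 : n ≠ 0 := by exact_mod_cast hn0.ne'
  refine ⟨Set.range fun j : ℕ => ((n * j : ℕ) : 𝓞 K), Set.infinite_range_of_injective ?_, ?_⟩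
  · exact fun i j hij => Nat.eq_of_mul_eq_mul_left (Nat.pos_of_ne_zero hn1) (Nat.cast_injective hij)
  · rintro _ ⟨i, rfl⟩ _ ⟨j, rfl⟩ hij
    have hij' : (i : ℤ) - j ≠ 0 := by
      rintro h
      apply hij
      rw [show i = j by omega]
    have h1 : (1 : ℝ) ≤ |(i : ℝ) - j| := by exact_mod_cast Int.one_le_abs hij'
    refine (Set.disjoint_image_iff OnePoint.coe_injective).2 (Metric.ball_disjoint_ball ?_)
    have h2 : dist (c + σ (((n * i : ℕ) : 𝓞 K) : K)) (c + σ (((n * j : ℕ) : 𝓞 K) : K)) =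
        n * |(i : ℝ) - j| := by
      rw [dist_add_left, Complex.dist_eq]
      have : σ (((n * i : ℕ) : 𝓞 K) : K) - σ (((n * j : ℕ) : 𝓞 K) : K) =
          ((n * (i - j) : ℝ) : ℂ) := by
        simp
        ring
      rw [this, Complex.norm_real, Real.norm_eq_abs, abs_mul, abs_of_pos hn0]
    rw [h2]
    have h3 : 2 * r < n := (le_max_right _ _).trans_lt hn
    nlinarith

end Components

/-! ### Ghost circles and the arrangement -/

section Main

variable {K : Type*} [Field K] [NumberField K] [Algebra.IsQuadraticExtension ℚ K]
  [NumberField.IsTotallyComplex K]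

/-- Lattice translations permute the Bianchi circles, so the untranslated ghost circle suffices. -/
theorem disjoint_bianchiCircle_ghostCircle (hd : NumberField.discr K < -12) (σ : K →+* ℂ)
    (M : SL(2, 𝓞 K)) (l : 𝓞 K) : Disjoint (bianchiCircle σ M)
      (circle (ghostCenter K + σ l) √(Complex.normSq (ghostCenter K) - 1)) := by
  rw [Set.disjoint_left]
  rintro _ ⟨x, hx, hxz⟩ ⟨z, hz, rfl⟩
  rw [mem_sphere_iff_norm] at hz
  have h1 : toGLComplex σ (translation (-l) * M) • x = ((z - σ l : ℂ) : OnePoint ℂ) := by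
    have hxz' : toGLComplex σ M • x = (z : OnePoint ℂ) := hxz
    rw [toGLComplex_mul, mul_smul, hxz', translation_smul_coe]
    simp [sub_eq_add_neg]
  refine normSq_sub_ghostCenter_ne hd σ _ hx h1 ?_
  have := one_lt_normSq_ghostCenter hd (ringOfIntegers_coordinates K σ).2.1
  rw [← Complex.sq_norm, sub_sub, add_comm, hz, Real.sq_sqrt (by linarith)]

theorem disjoint_arrangement_ghostCircle (hd : NumberField.discr K < -12) (σ : K →+* ℂ)
    (l : 𝓞 K) : Disjoint (arrangement σ)
      (circle (ghostCenter K + σ l) √(Complex.normSq (ghostCenter K) - 1)) := by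
  rw [arrangement, Set.disjoint_sUnion_left]
  rintro _ ⟨M, rfl⟩
  exact disjoint_bianchiCircle_ghostCircle hd σ M l

theorem nonempty_arrangement_inter_inside (σ : K →+* ℂ) (c : ℂ) {r : ℝ} (hr : 0 < r) :
    (arrangement σ ∩ inside c r).Nonempty := by
  obtain ⟨z, hz, hz'⟩ := exists_mem_ball_mem_arrangement σ c hr
  exact ⟨z, hz', z, hz, rfl⟩

end Main

end Schmidt

end

theorem mainTheorem2 (K : Type*) [Field K] [NumberField K]
    [Algebra.IsQuadraticExtension ℚ K] [NumberField.IsTotallyComplex K] (σ : K →+* ℂ) :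
    (IsConnected (Schmidt.arrangement σ) ↔ Schmidt.IsEuclidean (𝓞 K)) ∧
    (¬ IsConnected (Schmidt.arrangement σ) →
      Infinite (ConnectedComponents (Schmidt.arrangement σ))) ∧
    (¬ IsConnected (Schmidt.arrangement σ) →
      ∃ G : EuclideanGeometry.Sphere ℂ, Schmidt.IsGhostCircle K G ∧
        (∀ l : 𝓞 K,
          (∀ C, Schmidt.IsBianchiCircle σ C →
            Disjoint C (Schmidt.circle (G.center + σ l) G.radius)) ∧
          (Schmidt.arrangement σ ∩ Schmidt.inside (G.center + σ l) G.radius).Nonempty ∧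
          (Schmidt.arrangement σ ∩ Schmidt.outside (G.center + σ l) G.radius).Nonempty) ∧
        ∃ L : Set (𝓞 K), L.Infinite ∧
          L.PairwiseDisjoint fun l => Schmidt.inside (G.center + σ l) G.radius) := by
  have hne := Schmidt.discr_ne_neg_twelve K σ
  have hE : ¬ IsConnected (Schmidt.arrangement σ) → NumberField.discr K < -12 := by
    intro h
    by_contra hd
    exact h (Schmidt.isConnected_arrangement σ (Schmidt.isEuclidean_of_discr σ (by omega)))
  have hpos (hd : NumberField.discr K < -12) : 1 < Complex.normSq (Schmidt.ghostCenter K) :=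
    Schmidt.one_lt_normSq_ghostCenter hd (Schmidt.ringOfIntegers_coordinates K σ).2.1
  have hinf (hd : NumberField.discr K < -12) :
      Infinite (ConnectedComponents (Schmidt.arrangement σ)) := by
    obtain ⟨L, hL, hL'⟩ := Schmidt.exists_infinite_pairwiseDisjoint_inside σ
      (Schmidt.ghostCenter K) √(Complex.normSq (Schmidt.ghostCenter K) - 1)
    exact Schmidt.infinite_connectedComponents hL hL'
      (Schmidt.disjoint_arrangement_ghostCircle hd σ) fun l =>
        Schmidt.nonempty_arrangement_inter_inside σ _
          (Real.sqrt_pos.2 (sub_pos.2 (hpos hd)))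
  refine ⟨⟨fun h => ?_, Schmidt.isConnected_arrangement σ⟩, fun h => hinf (hE h), fun h => ?_⟩
  -- If Δ < −12 there would be infinitely many components, but a connected space has only one.
  · refine Schmidt.isEuclidean_of_discr σ ?_
    by_contra hd
    have := hinf (by omega)
    have := isConnected_iff_connectedSpace.1 h
    exact not_finite (ConnectedComponents (Schmidt.arrangement σ))
  · have hd := hE h
    refine ⟨_, Schmidt.isGhostCircle (hpos hd), fun l => ⟨?_, ?_, ?_⟩,
      Schmidt.exists_infinite_pairwiseDisjoint_inside σ _ _⟩
    · rintro _ ⟨M, rfl⟩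
      exact Schmidt.disjoint_bianchiCircle_ghostCircle hd σ M l
    · exact Schmidt.nonempty_arrangement_inter_inside σ _
        (Real.sqrt_pos.2 (sub_pos.2 (hpos hd)))
    · refine ⟨_, Schmidt.infty_mem_arrangement σ, ?_⟩
      rw [Schmidt.outside]
      rintro ⟨z, -, hz⟩
      exact OnePoint.coe_ne_infty z hz
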